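/- Let $4\le n\le 8$, and consider the Dynkin diagram with nodes $0,1,\dots,n$ in which $0,1,\dots,n-1$ form a chain and $n$ is attached to $n-3$ (so that the nodes $1,\dots,n$ form the diagram of $E_n$). Let $A$ be its Cartan matrix: $A_{00}=0$, $A_{ii}=2$ for $i\ge 1$, and for $i\neq j$, $A_{ij}=-1$ if $i,j$ are connected and $A_{ij}=0$ otherwise. Let $\tilde U$ be the real Lie superalgebra generated by $e_I,f_I,h_I$ ($0\le I\le n$), all even except the odd elements $e_0,f_0$, with relations $[\![h_I,e_J]\!]=A_{IJ}e_J$, $[\![h_I,f_J]\!]=-A_{IJ}f_J$, $[\![e_I,f_J]\!]=\delta_{IJ}h_J$, $[\![h_I,h_J]\!]=0$, and let the Borcherds superalgebra $U_{n+1}$ be its quotient by the maximal ideal that intersects the span of the $h_I$ trivially. It is $\mathbb Z$-graded by level: $e_0$ has level $-1$, $f_0$ has level $1$, and all other generators have level $0$; the parity of an element is that of its level. Let $\langle\cdot|\cdot\rangle$ be the bilinear form on $U_{n+1}$ that is invariant, $\langle[\![x,y]\!]|z\rangle=\langle x|[\![y,z]\!]\rangle$, supersymmetric, $\langle x|y\rangle=(-1)^{pq}\langle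 y|x\rangle$ for $x,y$ of levels $p,q$, vanishes on levels $p,q$ with $p+q\neq 0$, and satisfies $\langle h_I|h_J\rangle=A_{IJ}$, $\langle e_I|f_J\rangle=\delta_{IJ}$, $\langle e_I|e_J\rangle=\langle f_I|f_J\rangle=0$. Let $(E_M)$ and $(F^N)$ be bases, with the same finite index set, of the subspaces of level $-1$ and $1$, with $\langle E_M|F^N\rangle=\delta_M{}^N$, and set $$E_{M_1\cdots M_k}=[\![E_{M_1},[\![E_{M_2},\dots,[\![E_{M_{k-1}},E_{M_k}]\!]\cdots]\!]]\!],\qquad F^{N_1\cdots N_k}=[\![F^{N_1},[\![F^{N_2},\dots,[\![F^{N_{k-1}},F^{N_k}]\!]\cdots]\!]]\!].$$ Let $\mathbf s_k$ be the representation of $E_n$ on level $k$, and let $(\mathbb P_k)_{M_1\cdots M_k}{}^{N_1\cdots N_k}$ be the projector corresponding to $\mathbf s_k$: the idempotent matrix such that $\sum_M c^{M_1\cdots M_k}(\mathbb P_k)_{M_1\cdots M_k}{}^{N_1\cdots N_k}=0$ for all $N_1,\dots,N_k$ if and only if $\sum_M c^{M_1\cdots M_k}E_{M_1\cdots M_k}=0$,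 and $\sum_N (\mathbb P_k)_{M_1\cdots M_k}{}^{N_1\cdots N_k}c_{N_1\cdots N_k}=0$ for all $M_1,\dots,M_k$ if and only if $\sum_N c_{N_1\cdots N_k}F^{N_1\cdots N_k}=0$. Repeated indices are summed, and angle brackets denote projection: $T^{\langle N_1\cdots N_p\rangle}=(\mathbb P_p)_{K_1\cdots K_p}{}^{N_1\cdots N_p}T^{K_1\cdots K_p}$ and $T_{\langle M_1\cdots M_p\rangle}=(\mathbb P_p)_{M_1\cdots M_p}{}^{K_1\cdots K_p}T_{K_1\cdots K_p}$. **Theorem.** Let $p\ge 2$ be an integer, put $a_1=1$, and suppose that there are real numbers $a_2,\dots,a_p$ with $$\langle E_{M_1\cdots M_k}|F^{N_1\cdots N_k}\rangle=a_k\,(\mathbb P_k)_{M_1\cdots M_k}{}^{N_1\cdots N_k}\qquad (k=2,3,\dots,p).$$ Then the following identities hold for all values of the free indices: $$[\![E_M,F^{N_1\cdots N_p}]\!]=(-1)^p\,\frac{a_p}{a_{p-1}}\,\delta_M{}^{\langle N_1}F^{N_2\cdots N_p\rangle},$$ $$[\![E_{M_2\cdots M_p},F^{N_1\cdots N_p}]\!]=a_p\,F^{\langle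 N_1}\delta_{M_2}{}^{N_2}\cdots\delta_{M_p}{}^{N_p\rangle},$$ $$[\![E_{M_1\cdots M_p},F^{N_1\cdots N_p}]\!]=a_p\sum_{i=1}^p (\mathbb P_p)_{M_1\cdots M_p}{}^{K_1\cdots K_p}\,\{E_{K_i},F^{N_i}\}\prod_{j\neq i}\delta_{K_j}{}^{N_j}.$$ (If $a_{p-1}=0$, which can only happen when the subspaces of levels $\pm(p-1)$ vanish, the right-hand side of the first identity is read as $0$.) -/

import Mathlib

open scoped BigOperators Matrix

noncomputable section

namespace BorcherdsE

/-! ## Cartan matrix and free generators -/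

/-- Nodes `i < j` of the extended diagram are joined by an edge: the nodes `0, 1, …, n - 1` form a
chain, and the node `n` is attached to the node `n - 3`. -/
def JoinedLt (n i j : ℕ) : Prop := (i + 1 = j ∧ j < n) ∨ (i + 3 = j ∧ j = n)

instance (n i j : ℕ) : Decidable (JoinedLt n i j) := by unfold JoinedLt; infer_instance

/-- The Cartan matrix of the Dynkin diagram of `E_n` (nodes `1, …, n`) extended by the black node
`0`, which is attached to the node `1` and has vanishing diagonal entry. -/
def cartan (n : ℕ) : Matrix (Fin (n + 1)) (Fin (n + 1)) ℤ := fun i j =>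
  if i = j then (if i = 0 then 0 else 2)
  else if JoinedLt n i j ∨ JoinedLt n j i then -1 else 0

/-- The `3 (n + 1)` Chevalley generators. -/
inductive Gen (n : ℕ) : Type
  | e (i : Fin (n + 1)) : Gen n
  | f (i : Fin (n + 1)) : Gen n
  | h (i : Fin (n + 1)) : Gen n

/-- The level of a Chevalley generator. The odd generators are those of odd level. -/
def Gen.level {n : ℕ} : Gen n → ℤ
  | .e i => if i = 0 then -1 else 0
  | .f i => if i = 0 then 1 else 0
  | .h _ => 0

/-- The level of an iterated bracket of Chevalley generators. -/
def wordLevel {n : ℕ} : FreeMagma (Gen n) → ℤ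
  | .of g => g.level
  | .mul x y => wordLevel x + wordLevel y

/-- The sign `(-1)^(p q)` of an exchange of elements of levels `p` and `q`. -/
def sgn (p q : ℤ) : ℝ := (-1 : ℝ) ^ (p * q)

/-- The free non-associative real algebra on the Chevalley generators; its product plays the role
of the superbracket. -/
abbrev FreeAlg (n : ℕ) : Type := FreeNonUnitalNonAssocAlgebra ℝ (Gen n)

/-- An iterated bracket of generators, as an element of the free algebra. -/
def word {n : ℕ} (x : FreeMagma (Gen n)) : FreeAlg n := MonoidAlgebra.ofMagma ℝ _ x

/-- A generator, as an element of the free algebra. -/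
def gen {n : ℕ} (g : Gen n) : FreeAlg n := word (FreeMagma.of g)

/-! ## Ideals and quotients of a (non-associative) bilinear product -/

section Ideals

variable {V : Type} [AddCommGroup V] [Module ℝ V]

/-- A two-sided ideal for the bilinear product `m`. -/
def IsIdeal (m : V →ₗ[ℝ] V →ₗ[ℝ] V) (I : Submodule ℝ V) : Prop :=
  ∀ x ∈ I, ∀ y, m x y ∈ I ∧ m y x ∈ I

/-- The ideal generated by a set. -/
def idealSpan (m : V →ₗ[ℝ] V →ₗ[ℝ] V) (S : Set V) : Submodule ℝ V :=
  sInf {I | IsIdeal m I ∧ S ⊆ I}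

/-- The sum of all ideals that intersect the subspace `H` trivially. -/
def idealAvoiding (m : V →ₗ[ℝ] V →ₗ[ℝ] V) (H : Submodule ℝ V) : Submodule ℝ V :=
  sSup {I | IsIdeal m I ∧ I ⊓ H = ⊥}

theorem isIdeal_idealSpan (m : V →ₗ[ℝ] V →ₗ[ℝ] V) (S : Set V) : IsIdeal m (idealSpan m S) := by
  intro x hx y
  simp only [idealSpan, Submodule.mem_sInf, Set.mem_ofPred_eq] at hx ⊢
  exact ⟨fun I hI => (hI.1 x (hx I hI) y).1, fun I hI => (hI.1 x (hx I hI) y).2⟩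

theorem isIdeal_idealAvoiding (m : V →ₗ[ℝ] V →ₗ[ℝ] V) (H : Submodule ℝ V) :
    IsIdeal m (idealAvoiding m H) := by
  intro x hx y
  constructor
  · have h : idealAvoiding m H ≤ (idealAvoiding m H).comap (m.flip y) :=
      sSup_le fun I hI z hz => (le_sSup (a := I) hI : I ≤ idealAvoiding m H) (hI.1 z hz y).1
    exact h hx
  · have h : idealAvoiding m H ≤ (idealAvoiding m H).comap (m y) :=
      sSup_le fun I hI z hz => (le_sSup (a := I) hI : I ≤ idealAvoiding m H) (hI.1 z hz y).2
    exact h hx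

/-- The product induced on the quotient by an ideal: `[x] [y] = [x y]`. -/
def quotProduct (m : V →ₗ[ℝ] V →ₗ[ℝ] V) (I : Submodule ℝ V) (hI : IsIdeal m I) :
    (V ⧸ I) →ₗ[ℝ] (V ⧸ I) →ₗ[ℝ] (V ⧸ I) :=
  I.liftQ
    { toFun := fun x => I.liftQ (I.mkQ ∘ₗ m x)
        (fun y hy => by simpa using (hI y hy x).2)
      map_add' := fun x x' => by ext y; simp
      map_smul' := fun c x => by ext y; simp }
    (fun x hx => by ext y; simpa using (hI x hx y).1)

theorem quotProduct_mk (m : V →ₗ[ℝ] V →ₗ[ℝ] V) (I : Submodule ℝ V) (hI : IsIdeal m I) (x y : V) :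
    quotProduct m I hI (I.mkQ x) (I.mkQ y) = I.mkQ (m x y) := rfl

end Ideals

/-! ## The Lie superalgebra `Ũ` given by the Chevalley relations -/

/-- Graded antisymmetry, the graded Jacobi identity, and the Chevalley relations. -/
inductive Rel (n : ℕ) : FreeAlg n → Prop
  | skew (x y : FreeMagma (Gen n)) :
      Rel n (word x * word y + sgn (wordLevel x) (wordLevel y) • (word y * word x))
  | jacobi (x y z : FreeMagma (Gen n)) :
      Rel n ((word x * word y) * word z - (word x * (word y * word z)
        - sgn (wordLevel x) (wordLevel y) • (word y * (word x * word z))))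
  | he (i j : Fin (n + 1)) : Rel n (gen (.h i) * gen (.e j) - (cartan n i j : ℝ) • gen (.e j))
  | hf (i j : Fin (n + 1)) : Rel n (gen (.h i) * gen (.f j) + (cartan n i j : ℝ) • gen (.f j))
  | ef (i j : Fin (n + 1)) : Rel n (gen (.e i) * gen (.f j) - if i = j then gen (.h j) else 0)
  | hh (i j : Fin (n + 1)) : Rel n (gen (.h i) * gen (.h j))

/-- The ideal of the free algebra generated by all relations. -/
def relIdeal (n : ℕ) : Submodule ℝ (FreeAlg n) :=
  idealSpan (LinearMap.mul ℝ (FreeAlg n)) {x | Rel n x}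

/-- The Lie superalgebra `Ũ` with the Chevalley generators and the Chevalley relations. -/
abbrev UTilde (n : ℕ) : Type := FreeAlg n ⧸ relIdeal n

/-- The superbracket of `Ũ`. -/
def tildeBracket (n : ℕ) : UTilde n →ₗ[ℝ] UTilde n →ₗ[ℝ] UTilde n :=
  quotProduct (LinearMap.mul ℝ (FreeAlg n)) (relIdeal n) (isIdeal_idealSpan _ _)

/-- The Cartan subalgebra of `Ũ`, spanned by the elements `h_i`. -/
def tildeCartan (n : ℕ) : Submodule ℝ (UTilde n) :=
  Submodule.span ℝ (Set.range fun i => (relIdeal n).mkQ (gen (.h i)))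

/-- The maximal ideal of `Ũ` that intersects the Cartan subalgebra trivially. -/
def maxIdeal (n : ℕ) : Submodule ℝ (UTilde n) := idealAvoiding (tildeBracket n) (tildeCartan n)

/-! ## The Borcherds superalgebra `U_{n+1}` -/

/-- The Borcherds superalgebra `U_{n+1}`. -/
def U (n : ℕ) : Type := UTilde n ⧸ maxIdeal n

instance (n : ℕ) : AddCommGroup (U n) := inferInstanceAs (AddCommGroup (UTilde n ⧸ maxIdeal n))

instance (n : ℕ) : Module ℝ (U n) := inferInstanceAs (Module ℝ (UTilde n ⧸ maxIdeal n))

/-- The superbracket of `U_{n+1}` as a bilinear map. -/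
def superBracket (n : ℕ) : U n →ₗ[ℝ] U n →ₗ[ℝ] U n :=
  quotProduct (tildeBracket n) (maxIdeal n) (isIdeal_idealAvoiding _ _)

/-- The superbracket `⟦x, y⟧` of `U_{n+1}` is written `⁅x, y⁆`. -/
instance (n : ℕ) : Bracket (U n) (U n) := ⟨fun x y => superBracket n x y⟩

/-- The canonical map from the free algebra onto `U_{n+1}`. -/
def toU (n : ℕ) : FreeAlg n →ₗ[ℝ] U n :=
  LinearMap.comp (Submodule.mkQ (maxIdeal n)) (Submodule.mkQ (relIdeal n))

/-- The generator `e_i` of `U_{n+1}`. -/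
def e {n : ℕ} (i : Fin (n + 1)) : U n := toU n (gen (.e i))

/-- The generator `f_i` of `U_{n+1}`. -/
def f {n : ℕ} (i : Fin (n + 1)) : U n := toU n (gen (.f i))

/-- The generator `h_i` of `U_{n+1}`. -/
def h {n : ℕ} (i : Fin (n + 1)) : U n := toU n (gen (.h i))

/-- The subspace `(U_{n+1})_p` of level `p`, spanned by the iterated brackets of generators that
have total level `p`, where `e_0` has level `-1`, `f_0` has level `1`, and all other generators
have level `0`. Its elements are even or odd according to the parity of `p`. -/
def level (n : ℕ) (p : ℤ) : Submodule ℝ (U n) :=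
  Submodule.span ℝ {u | ∃ x : FreeMagma (Gen n), wordLevel x = p ∧ u = toU n (word x)}

/-! ## The invariant bilinear form -/

/-- The properties that define the bilinear form on `U_{n+1}`; they determine it uniquely. -/
structure IsStandardForm (n : ℕ) (B : LinearMap.BilinForm ℝ (U n)) : Prop where
  hh : ∀ i j, B (h i) (h j) = (cartan n i j : ℝ)
  ef : ∀ i j, B (e i) (f j) = if i = j then 1 else 0
  ee : ∀ i j, B (e i) (e j) = 0
  ff : ∀ i j, B (f i) (f j) = 0
  invariant : ∀ x y z : U n, B ⁅x, y⁆ z = B x ⁅y, z⁆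
  supersymm : ∀ p q : ℤ, ∀ x ∈ level n p, ∀ y ∈ level n q, B x y = sgn p q * B y x
  orthogonal : ∀ p q : ℤ, p + q ≠ 0 → ∀ x ∈ level n p, ∀ y ∈ level n q, B x y = 0

open Classical in
/-- The bilinear form `⟨x | y⟩` on `U_{n+1}`: the unique form with the properties listed in
`IsStandardForm` (such a form exists because the Cartan matrix is symmetric; the value `0` only
makes the definition total). -/
def form (n : ℕ) : LinearMap.BilinForm ℝ (U n) :=
  if hB : ∃ B, IsStandardForm n B then hB.choose else 0

/-! ## Tensor notation -/

section Tensors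

variable {ι : Type} {V : Type}

/-- The iterated bracket `X_{M_1 ⋯ M_k} = ⟦X_{M_1}, ⟦X_{M_2}, …, ⟦X_{M_{k-1}}, X_{M_k}⟧ ⋯ ⟧⟧`
(with value `0` for the empty list of indices, which is not used). -/
def nested [Zero V] [Bracket V V] (X : ι → V) : (k : ℕ) → (Fin k → ι) → V
  | 0, _ => 0
  | 1, M => X (M 0)
  | k + 2, M => ⁅X (M 0), nested X (k + 1) (Fin.tail M)⁆

variable [Fintype ι]

/-- `P = (P_k)_{M_1⋯M_k}^{N_1⋯N_k}` is the projector corresponding to the representation on levels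
`-k` and `k`: it is idempotent, contracting its lower indices with coefficients `c` gives zero
exactly if `c` is a relation among the `E_{M_1⋯M_k}`, and contracting its upper indices with
coefficients `c` gives zero exactly if `c` is a relation among the `F^{N_1⋯N_k}`. In particular
`E_M = P_M^N E_N` and `F^N = P_M^N F^M`, and there is at most one such `P`. -/
structure IsLevelProjector {n : ℕ} (E F : ι → U n) {k : ℕ}
    (P : Matrix (Fin k → ι) (Fin k → ι) ℝ) : Prop where
  idem : P * P = P
  lower : ∀ c : (Fin k → ι) → ℝ, c ᵥ* P = 0 ↔ ∑ M, c M • nested E k M = 0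
  upper : ∀ c : (Fin k → ι) → ℝ, P *ᵥ c = 0 ↔ ∑ N, c N • nested F k N = 0

variable [AddCommGroup V] [Module ℝ V] {k : ℕ}

/-- Projection of upper indices, `T^{⟨N_1⋯N_k⟩} = P_{K_1⋯K_k}^{N_1⋯N_k} T^{K_1⋯K_k}`. -/
def projUpper (P : Matrix (Fin k → ι) (Fin k → ι) ℝ) (T : (Fin k → ι) → V) (N : Fin k → ι) : V :=
  ∑ K, P K N • T K

/-- Projection of lower indices, `T_{⟨M_1⋯M_k⟩} = P_{M_1⋯M_k}^{K_1⋯K_k} T_{K_1⋯K_k}`. -/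
def projLower (P : Matrix (Fin k → ι) (Fin k → ι) ℝ) (T : (Fin k → ι) → V) (M : Fin k → ι) : V :=
  ∑ K, P M K • T K

end Tensors

end BorcherdsE

end

noncomputable section

namespace BorcherdsE

variable {n : ℕ}

/-! ## The superbracket on the Borcherds superalgebra -/

/-! Each identity is tested by pairing it with elements of opposite level, where invariance of the
form reduces it to the assumed values of ⟨E_{M_1⋯M_k}|F^{N_1⋯N_k}⟩. Two facts make such a test
sufficient. First, the form is nondegenerate (`eq_zero_of_forall`): its radical is an ideal, and it
meets the Cartan subalgebra trivially because A is invertible, so it lies in the maximal ideal that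
was factored out. Second, level ±k, for k ≥ 1, is spanned by k-fold nested brackets of level ±1
(`level_le_generatedLevel`, `levelPower_le_span_nested`), so on level k only pairings with the
E_{M_1⋯M_k} matter.

For the second identity, ⟨E_L|⟦E_M,F^N⟧⟩ = ⟨E_{LM}|F^N⟩ is the hypothesis itself. For the first, the
bracket of E_{M'} with E_M has to be reversed, which gives the sign, and P_{p-1} has to disappear
into P_p (`projector_absorb`). For the third, the test elements x have level 0. Moving x onto F^N
makes it act as a derivation, and its matrix on level 1 is -⟨x|⟦E_L,F^j⟧⟩. -/

theorem word_mul (x y : FreeMagma (Gen n)) : word (x * y) = word x * word y :=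
  map_mul (MonoidAlgebra.ofMagma ℝ (FreeMagma (Gen n))) x y

theorem toU_mul (a b : FreeAlg n) : toU n (a * b) = superBracket n (toU n a) (toU n b) := rfl

theorem toU_word_mul (x y : FreeMagma (Gen n)) :
    toU n (word (x * y)) = superBracket n (toU n (word x)) (toU n (word y)) := by
  rw [word_mul, toU_mul]

theorem bracket_eq (x y : U n) : ⁅x, y⁆ = superBracket n x y := rfl

theorem toU_surjective : Function.Surjective (toU n) := by
  exact (Submodule.mkQ_surjective (maxIdeal n)).comp (Submodule.mkQ_surjective (relIdeal n))

theorem span_toU_word :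
    Submodule.span ℝ (Set.range fun x : FreeMagma (Gen n) => toU n (word x)) = ⊤ := by
  have h : Submodule.span ℝ (Set.range fun x : FreeMagma (Gen n) => (word x : FreeAlg n)) = ⊤ := by
    rw [eq_top_iff]
    intro a _
    induction a using MonoidAlgebra.induction_linear with
    | zero => exact zero_mem _
    | add a b ha hb => exact add_mem (ha trivial) (hb trivial)
    | single x r =>
      have : (MonoidAlgebra.single x r : FreeAlg n) = r • word x := by
        simp [word, MonoidAlgebra.ofMagma]
      rw [this]
      exact Submodule.smul_mem _ _ (Submodule.subset_span ⟨x, rfl⟩)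
  have h2 := congrArg (Submodule.map (toU n)) h
  rw [Submodule.map_span, ← Set.range_comp, Submodule.map_top,
    LinearMap.range_eq_top.2 toU_surjective] at h2
  exact h2

theorem toU_eq_zero_of_rel {a : FreeAlg n} (h : Rel n a) : toU n a = 0 := by
  have : a ∈ relIdeal n := by
    simp only [relIdeal, idealSpan, Submodule.mem_sInf]
    exact fun I hI => hI.2 h
  have h2 : (relIdeal n).mkQ a = 0 := by simpa using this
  change (maxIdeal n).mkQ ((relIdeal n).mkQ a) = 0
  rw [h2, map_zero]

theorem toU_word_mem_level (x : FreeMagma (Gen n)) : toU n (word x) ∈ level n (wordLevel x) :=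
  Submodule.subset_span ⟨x, rfl, rfl⟩

theorem level_induction {p : ℤ} {S : Submodule ℝ (U n)}
    (h : ∀ x : FreeMagma (Gen n), wordLevel x = p → toU n (word x) ∈ S) : level n p ≤ S := by
  refine Submodule.span_le.2 ?_
  rintro _ ⟨x, hx, rfl⟩
  exact h x hx

theorem wordLevel_mul (x y : FreeMagma (Gen n)) :
    wordLevel (x * y) = wordLevel x + wordLevel y := rfl

/-- Two linear maps that agree on all iterated brackets of generators agree. -/
theorem linearMap_ext {V : Type*} [AddCommGroup V] [Module ℝ V] {φ ψ : U n →ₗ[ℝ] V}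
    (h : ∀ x : FreeMagma (Gen n), φ (toU n (word x)) = ψ (toU n (word x))) : φ = ψ :=
  LinearMap.ext_on span_toU_word (by rintro _ ⟨x, rfl⟩; exact h x)

/-- The defining relations concern words only. A level is spanned by words of that level, so the
sign is constant there and bilinearity does the rest. -/
theorem bracket_skew {p q : ℤ} {x y : U n} (hx : x ∈ level n p) (hy : y ∈ level n q) :
    superBracket n x y = -(sgn p q • superBracket n y x) := by
  have h1 : level n p ≤ LinearMap.eqLocus ((superBracket n).flip y)
      (-(sgn p q • superBracket n y)) := by
    refine level_induction fun a ha => ?_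
    have h2 : level n q ≤ LinearMap.eqLocus (superBracket n (toU n (word a)))
        (-(sgn p q • (superBracket n).flip (toU n (word a)))) := by
      refine level_induction fun b hb => ?_
      have := toU_eq_zero_of_rel (Rel.skew a b)
      rw [map_add, map_smul, toU_mul, toU_mul, ha, hb] at this
      simpa using eq_neg_of_add_eq_zero_left this
    simpa using h2 hy
  simpa using h1 hx

/-- The sign involves only the levels of `x` and `y`, so `z` need not be homogeneous. -/
theorem bracket_jacobi {p q : ℤ} {x y : U n} (hx : x ∈ level n p) (hy : y ∈ level n q) (z : U n) :
    superBracket n (superBracket n x y) z =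
      superBracket n x (superBracket n y z) -
        sgn p q • superBracket n y (superBracket n x z) := by
  have h1 : level n p ≤ LinearMap.eqLocus ((superBracket n).flip z ∘ₗ (superBracket n).flip y)
      ((superBracket n).flip (superBracket n y z) -
        sgn p q • (superBracket n y ∘ₗ (superBracket n).flip z)) := by
    refine level_induction fun a ha => ?_
    have h2 : level n q ≤ LinearMap.eqLocus
        ((superBracket n).flip z ∘ₗ superBracket n (toU n (word a)))
        ((superBracket n (toU n (word a)) ∘ₗ (superBracket n).flip z) -
          sgn p q • (superBracket n).flip (superBracket n (toU n (word a)) z)) := by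
      refine level_induction fun b hb => ?_
      have h3 : superBracket n (superBracket n (toU n (word a)) (toU n (word b))) =
          superBracket n (toU n (word a)) ∘ₗ superBracket n (toU n (word b)) -
          sgn p q • (superBracket n (toU n (word b)) ∘ₗ superBracket n (toU n (word a))) := by
        refine linearMap_ext fun c => ?_
        have := toU_eq_zero_of_rel (Rel.jacobi a b c)
        rw [map_sub, map_sub, map_smul, ha, hb] at this
        simpa [toU_mul] using sub_eq_zero.1 this
      simpa using LinearMap.congr_fun h3 z
    simpa using h2 hy
  simpa using h1 hx

/-- The graded Leibniz rule for the adjoint action. -/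
theorem bracket_leibniz {p q : ℤ} {x y : U n} (hx : x ∈ level n p) (hy : y ∈ level n q) (z : U n) :
    superBracket n x (superBracket n y z) =
      superBracket n (superBracket n x y) z +
        sgn p q • superBracket n y (superBracket n x z) := by
  rw [bracket_jacobi hx hy, sub_add_cancel]

theorem bracket_mem_level {p q : ℤ} {x y : U n} (hx : x ∈ level n p) (hy : y ∈ level n q) :
    superBracket n x y ∈ level n (p + q) := by
  have h1 : level n p ≤ (level n (p + q)).comap ((superBracket n).flip y) := by
    refine level_induction fun a ha => ?_
    have h2 : level n q ≤ (level n (p + q)).comap (superBracket n (toU n (word a))) := by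
      refine level_induction fun b hb => ?_
      rw [Submodule.mem_comap, ← toU_word_mul, ← ha, ← hb, ← wordLevel_mul]
      exact toU_word_mem_level _
    exact h2 hy
  exact h1 hx

/-! ## Nondegeneracy of the invariant form -/

/-- Expanding along node 0 gives det A = -det E_{n-1} = n - 10, which is nonzero in this range. The
proof solves each of the five linear systems explicitly. -/
theorem cartan_nondegenerate (hn : 4 ≤ n) (hn' : n ≤ 8) (c : Fin (n + 1) → ℝ)
    (hc : ∀ j, ∑ i, c i * (cartan n i j : ℝ) = 0) : c = 0 := by
  interval_cases n
  · have hA : cartan 4 = !![0, -1, 0, 0, 0;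
      -1, 2, -1, 0, -1;
      0, -1, 2, -1, 0;
      0, 0, -1, 2, 0;
      0, -1, 0, 0, 2] := by decide
    simp only [hA] at hc
    have h0 := hc 0
    have h1 := hc 1
    have h2 := hc 2
    have h3 := hc 3
    have h4 := hc 4
    simp [Fin.sum_univ_succ] at h0 h1 h2 h3 h4
    ext i
    fin_cases i <;> simp <;> linarith
  · have hA : cartan 5 = !![0, -1, 0, 0, 0, 0;
      -1, 2, -1, 0, 0, 0;
      0, -1, 2, -1, 0, -1;
      0, 0, -1, 2, -1, 0;
      0, 0, 0, -1, 2, 0;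
      0, 0, -1, 0, 0, 2] := by decide
    simp only [hA] at hc
    have h0 := hc 0
    have h1 := hc 1
    have h2 := hc 2
    have h3 := hc 3
    have h4 := hc 4
    have h5 := hc 5
    simp [Fin.sum_univ_succ] at h0 h1 h2 h3 h4 h5
    ext i
    fin_cases i <;> simp <;> linarith
  · have hA : cartan 6 = !![0, -1, 0, 0, 0, 0, 0;
      -1, 2, -1, 0, 0, 0, 0;
      0, -1, 2, -1, 0, 0, 0;
      0, 0, -1, 2, -1, 0, -1;
      0, 0, 0, -1, 2, -1, 0;
      0, 0, 0, 0, -1, 2, 0;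
      0, 0, 0, -1, 0, 0, 2] := by decide
    simp only [hA] at hc
    have h0 := hc 0
    have h1 := hc 1
    have h2 := hc 2
    have h3 := hc 3
    have h4 := hc 4
    have h5 := hc 5
    have h6 := hc 6
    simp [Fin.sum_univ_succ] at h0 h1 h2 h3 h4 h5 h6
    ext i
    fin_cases i <;> simp <;> linarith
  · have hA : cartan 7 = !![0, -1, 0, 0, 0, 0, 0, 0;
      -1, 2, -1, 0, 0, 0, 0, 0;
      0, -1, 2, -1, 0, 0, 0, 0;
      0, 0, -1, 2, -1, 0, 0, 0;
      0, 0, 0, -1, 2, -1, 0, -1;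
      0, 0, 0, 0, -1, 2, -1, 0;
      0, 0, 0, 0, 0, -1, 2, 0;
      0, 0, 0, 0, -1, 0, 0, 2] := by decide
    simp only [hA] at hc
    have h0 := hc 0
    have h1 := hc 1
    have h2 := hc 2
    have h3 := hc 3
    have h4 := hc 4
    have h5 := hc 5
    have h6 := hc 6
    have h7 := hc 7
    simp [Fin.sum_univ_succ] at h0 h1 h2 h3 h4 h5 h6 h7
    ext i
    fin_cases i <;> simp <;> linarith
  · have hA : cartan 8 = !![0, -1, 0, 0, 0, 0, 0, 0, 0;
      -1, 2, -1, 0, 0, 0, 0, 0, 0;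
      0, -1, 2, -1, 0, 0, 0, 0, 0;
      0, 0, -1, 2, -1, 0, 0, 0, 0;
      0, 0, 0, -1, 2, -1, 0, 0, 0;
      0, 0, 0, 0, -1, 2, -1, 0, -1;
      0, 0, 0, 0, 0, -1, 2, -1, 0;
      0, 0, 0, 0, 0, 0, -1, 2, 0;
      0, 0, 0, 0, 0, -1, 0, 0, 2] := by decide
    simp only [hA] at hc
    have h0 := hc 0
    have h1 := hc 1
    have h2 := hc 2
    have h3 := hc 3
    have h4 := hc 4
    have h5 := hc 5
    have h6 := hc 6
    have h7 := hc 7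
    have h8 := hc 8
    simp [Fin.sum_univ_succ] at h0 h1 h2 h3 h4 h5 h6 h7 h8
    ext i
    fin_cases i <;> simp <;> linarith

namespace IsStandardForm

variable {B : LinearMap.BilinForm ℝ (U n)}

/-- Only words of level -q pair nontrivially with `y`, and (-1)^{-q·q} = (-1)^{q·q}; hence one sign
serves for every `x`. -/
theorem apply_eq_sgn_mul (hB : IsStandardForm n B) (x : U n) {q : ℤ} {y : U n}
    (hy : y ∈ level n q) : B x y = sgn q q * B y x := by
  have : B.flip y = sgn q q • B y := by
    refine linearMap_ext fun a => ?_
    have ha := toU_word_mem_level a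
    by_cases h : wordLevel a + q = 0
    · have hq : wordLevel a = -q := by lia
      have h2 := hB.supersymm _ _ _ ha _ hy
      have h3 : sgn (wordLevel a) q = sgn q q := by
        rw [sgn, sgn, hq, neg_mul, zpow_neg, ← inv_zpow, inv_neg_one]
      simpa [h3] using h2
    · simp [hB.orthogonal _ _ h _ ha _ hy,
        hB.orthogonal _ _ (by rwa [add_comm]) _ hy _ ha]
  simpa using LinearMap.congr_fun this x

/-- Left and right radicals coincide, which is what makes the radical a two-sided ideal. -/
theorem apply_eq_zero_comm (hB : IsStandardForm n B) (x : U n) :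
    (∀ y, B x y = 0) ↔ ∀ y, B y x = 0 := by
  constructor
  · intro h y
    have : B.flip x = 0 := by
      refine linearMap_ext fun a => ?_
      have ha := hB.apply_eq_sgn_mul x (toU_word_mem_level a)
      rw [h] at ha
      have h0 : sgn (wordLevel a) (wordLevel a) ≠ 0 := zpow_ne_zero _ (by norm_num)
      simpa [h0] using ha.symm
    simpa using LinearMap.congr_fun this y
  · intro h y
    have : B x = 0 := by
      refine linearMap_ext fun a => ?_
      rw [hB.apply_eq_sgn_mul x (toU_word_mem_level a), h]
      simp
    simp [this]

/-- The form is nondegenerate, because its radical is an ideal that meets the Cartan subalgebra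
trivially. -/
theorem eq_zero_of_forall (hB : IsStandardForm n B) (hn : 4 ≤ n) (hn' : n ≤ 8) {x : U n}
    (hx : ∀ y, B x y = 0) : x = 0 := by
  let π : UTilde n →ₗ[ℝ] U n := (maxIdeal n).mkQ
  have hπ (a b : UTilde n) : π (tildeBracket n a b) = superBracket n (π a) (π b) := rfl
  let I : Submodule ℝ (UTilde n) := (LinearMap.ker B).comap π
  have mem_I (a : UTilde n) : a ∈ I ↔ ∀ y, B (π a) y = 0 := by
    simp [I, LinearMap.ext_iff]
  have hI : IsIdeal (tildeBracket n) I := by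
    intro a ha b
    rw [mem_I] at ha
    rw [mem_I, mem_I, hπ, hπ]
    refine ⟨fun y => ?_, ?_⟩
    · rw [← bracket_eq, hB.invariant, ha]
    · rw [hB.apply_eq_zero_comm] at ha ⊢
      intro y
      rw [← bracket_eq, ← hB.invariant, ha]
  have hI2 : I ⊓ tildeCartan n = ⊥ := by
    rw [eq_bot_iff]
    rintro a ⟨ha, ha2⟩
    obtain ⟨c, rfl⟩ := (Submodule.mem_span_range_iff_exists_fun ℝ).1 ha2
    have hc : c = 0 := by
      refine cartan_nondegenerate hn hn' c fun j => ?_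
      have h1 := (mem_I _).1 ha (h j)
      rw [map_sum] at h1
      simp only [map_smul, map_sum, LinearMap.sum_apply, LinearMap.smul_apply] at h1
      rw [← h1]
      refine Finset.sum_congr rfl fun i _ => ?_
      rw [smul_eq_mul, ← hB.hh]
      rfl
    simp [hc]
  have hle : I ≤ maxIdeal n := le_sSup (a := I) ⟨hI, hI2⟩
  obtain ⟨a, rfl⟩ : ∃ a, π a = x := Submodule.mkQ_surjective _ x
  have : a ∈ maxIdeal n := hle ((mem_I a).2 hx)
  exact (Submodule.Quotient.mk_eq_zero _).2 this

/-- An element of level `p` is detected by its pairings with the elements of level `-p`. -/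
theorem eq_zero_of_forall_level (hB : IsStandardForm n B) (hn : 4 ≤ n) (hn' : n ≤ 8) {p : ℤ}
    {x : U n} (hx : x ∈ level n p) (h : ∀ y ∈ level n (-p), B y x = 0) : x = 0 := by
  refine hB.eq_zero_of_forall hn hn' ((hB.apply_eq_zero_comm x).2 fun y => ?_)
  have : B.flip x = 0 := by
    refine linearMap_ext fun a => ?_
    have ha := toU_word_mem_level a
    by_cases hp : wordLevel a = -p
    · exact h _ (hp ▸ ha)
    · exact hB.orthogonal _ _ (by lia) _ ha _ hx
  simpa using LinearMap.congr_fun this y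

end IsStandardForm

/-! ## The subalgebras of positive and negative level are generated by the levels `1` and `-1` -/

theorem sgn_zero_left (p : ℤ) : sgn 0 p = 1 := by simp [sgn]

/-- The span of the `k`-fold nested brackets of elements of level `ε`; level `0` if `k = 0`. -/
def levelPower (n : ℕ) (ε : ℤ) : ℕ → Submodule ℝ (U n)
  | 0 => level n 0
  | 1 => level n ε
  | k + 2 => Submodule.map₂ (superBracket n) (level n ε) (levelPower n ε (k + 1))

theorem bracket_mem_levelPower_succ {ε : ℤ} {k : ℕ} {x y : U n} (hx : x ∈ level n ε)
    (hy : y ∈ levelPower n ε k) : superBracket n x y ∈ levelPower n ε (k + 1) := by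
  cases k with
  | zero => exact add_zero ε ▸ bracket_mem_level hx hy
  | succ k => exact Submodule.apply_mem_map₂ _ hx hy

theorem levelPower_add_two_le {ε : ℤ} {k : ℕ} {S : Submodule ℝ (U n)}
    (h : ∀ x ∈ level n ε, ∀ y ∈ levelPower n ε (k + 1), superBracket n x y ∈ S) :
    levelPower n ε (k + 2) ≤ S :=
  Submodule.map₂_le.2 h

theorem bracket_level_zero_mem_levelPower {ε : ℤ} {x : U n} (hx : x ∈ level n 0) (k : ℕ) :
    ∀ y ∈ levelPower n ε k, superBracket n x y ∈ levelPower n ε k := by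
  induction k with
  | zero =>
    intro y hy
    have hy' : y ∈ level n 0 := hy
    have h := bracket_mem_level hx hy'
    rwa [zero_add] at h
  | succ k ih =>
    cases k with
    | zero =>
      intro y hy
      have hy' : y ∈ level n ε := hy
      have h := bracket_mem_level hx hy'
      rwa [zero_add] at h
    | succ k =>
      refine levelPower_add_two_le (S := (levelPower n ε (k + 2)).comap (superBracket n x))
        fun y hy z hz => ?_
      rw [Submodule.mem_comap, bracket_leibniz hx hy]
      refine add_mem ?_ (Submodule.smul_mem _ _ (bracket_mem_levelPower_succ hy (ih z hz)))
      exact bracket_mem_levelPower_succ (by simpa using bracket_mem_level hx hy) hz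

/-- By the Leibniz rule `x` either meets the outer factor, producing a level 0 element that
preserves the power, or passes to the inner factor, where induction applies. -/
theorem bracket_level_neg_mem_levelPower {ε : ℤ} {x : U n} (hx : x ∈ level n (-ε)) (k : ℕ) :
    ∀ y ∈ levelPower n ε (k + 1), superBracket n x y ∈ levelPower n ε k := by
  induction k with
  | zero =>
    intro y hy
    have hy' : y ∈ level n ε := hy
    have h := bracket_mem_level hx hy'
    rwa [neg_add_cancel] at h
  | succ k ih =>
    refine levelPower_add_two_le (S := (levelPower n ε (k + 1)).comap (superBracket n x))
      fun y hy z hz => ?_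
    rw [Submodule.mem_comap, bracket_leibniz hx hy]
    refine add_mem ?_ (Submodule.smul_mem _ _ (bracket_mem_levelPower_succ hy (ih z hz)))
    exact bracket_level_zero_mem_levelPower (by simpa using bracket_mem_level hx hy) _ z hz

/-- The `m`-th component of the grading generated by the levels `-1`, `0` and `1`. -/
def generatedLevel (n : ℕ) : ℤ → Submodule ℝ (U n)
  | .ofNat k => levelPower n 1 k
  | .negSucc k => levelPower n (-1) (k + 1)

theorem generatedLevel_natCast (k : ℕ) : generatedLevel n k = levelPower n 1 k := rfl

theorem generatedLevel_neg_natCast (k : ℕ) : generatedLevel n (-k) = levelPower n (-1) k := by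
  cases k <;> rfl

theorem Gen.level_cases (g : Gen n) : g.level = 0 ∨ g.level = 1 ∨ g.level = -1 := by
  rcases g with i | i | i
  · by_cases hi : i = 0 <;> simp [Gen.level, hi]
  · by_cases hi : i = 0 <;> simp [Gen.level, hi]
  · exact Or.inl rfl

theorem gen_mem_generatedLevel (g : Gen n) : toU n (gen g) ∈ generatedLevel n g.level := by
  have h : toU n (gen g) ∈ level n g.level := toU_word_mem_level (FreeMagma.of g)
  rcases g.level_cases with h3 | h3 | h3 <;> rw [h3] at h ⊢ <;> exact h

theorem bracket_gen_mem_generatedLevel (g : Gen n) (m : ℤ) {y : U n}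
    (hy : y ∈ generatedLevel n m) :
    superBracket n (toU n (gen g)) y ∈ generatedLevel n (g.level + m) := by
  have h : toU n (gen g) ∈ level n g.level := toU_word_mem_level (FreeMagma.of g)
  rcases g.level_cases with h3 | h3 | h3 <;> rw [h3] at h ⊢
  · rw [zero_add]
    cases m with
    | ofNat k => exact bracket_level_zero_mem_levelPower h k y hy
    | negSucc k => exact bracket_level_zero_mem_levelPower h (k + 1) y hy
  · cases m with
    | ofNat k =>
      rw [show 1 + Int.ofNat k = ((k + 1 : ℕ) : ℤ) by simp [add_comm]]
      exact bracket_mem_levelPower_succ h hy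
    | negSucc k =>
      rw [show 1 + Int.negSucc k = -(k : ℤ) by lia, generatedLevel_neg_natCast]
      exact bracket_level_neg_mem_levelPower (by simpa using h) k y hy
  -- A generator of level -1 lengthens nested brackets when m ≤ 0 and shortens them when m > 0.
  · obtain ⟨k, rfl | rfl⟩ : ∃ k : ℕ, m = -k ∨ m = (k + 1 : ℕ) := by
      cases m with
      | ofNat k =>
        cases k with
        | zero => exact ⟨0, Or.inl rfl⟩
        | succ k => exact ⟨k, Or.inr rfl⟩
      | negSucc k => exact ⟨k + 1, Or.inl rfl⟩
    · rw [generatedLevel_neg_natCast] at hy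
      rw [show -1 + -(k : ℤ) = -((k + 1 : ℕ) : ℤ) by push_cast; ring, generatedLevel_neg_natCast]
      exact bracket_mem_levelPower_succ h hy
    · rw [show -1 + ((k + 1 : ℕ) : ℤ) = k by push_cast; ring]
      exact bracket_level_neg_mem_levelPower h k y hy

/-- By Jacobi, the adjoint action of a product is a graded commutator of adjoint actions, so the
case of generators suffices. -/
theorem bracket_word_mem_generatedLevel (x : FreeMagma (Gen n)) :
    ∀ (m : ℤ), ∀ y ∈ generatedLevel n m,
      superBracket n (toU n (word x)) y ∈ generatedLevel n (wordLevel x + m) := by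
  induction x using FreeMagma.rec with
  | of g => exact fun m y hy => bracket_gen_mem_generatedLevel g m hy
  | mul a b iha ihb =>
    intro m y hy
    change superBracket n (toU n (word (a * b))) y ∈ _
    rw [toU_word_mul, bracket_jacobi (toU_word_mem_level a) (toU_word_mem_level b)]
    refine sub_mem ?_ (Submodule.smul_mem _ _ ?_)
    · rw [show wordLevel (a.mul b) + m = wordLevel a + (wordLevel b + m) by
        rw [wordLevel, add_assoc]]
      exact iha _ _ (ihb _ _ hy)
    · rw [show wordLevel (a.mul b) + m = wordLevel b + (wordLevel a + m) by
        rw [wordLevel]; ring]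
      exact ihb _ _ (iha _ _ hy)

theorem level_le_generatedLevel (p : ℤ) : level n p ≤ generatedLevel n p := by
  refine level_induction fun x hx => ?_
  subst hx
  induction x using FreeMagma.rec with
  | of g => exact gen_mem_generatedLevel g
  | mul a b _ ihb =>
    change toU n (word (a * b)) ∈ _
    rw [toU_word_mul]
    exact bracket_word_mem_generatedLevel a _ _ ihb

/-! ## Nested brackets -/

section Nested

variable {ι : Type}

theorem nested_one (X : ι → U n) (M : Fin 1 → ι) : nested X 1 M = X (M 0) := rfl

theorem nested_add_two (X : ι → U n) (k : ℕ) (M : Fin (k + 2) → ι) :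
    nested X (k + 2) M = superBracket n (X (M 0)) (nested X (k + 1) (Fin.tail M)) := rfl

theorem nested_cons (X : ι → U n) (k : ℕ) (i : ι) (M : Fin (k + 1) → ι) :
    nested X (k + 2) (Fin.cons i M : Fin (k + 2) → ι) =
      superBracket n (X i) (nested X (k + 1) M) := by
  rw [nested_add_two, Fin.cons_zero, Fin.tail_cons]

theorem nested_mem_level {ε : ℤ} {X : ι → U n} (hX : ∀ M, X M ∈ level n ε) (k : ℕ) :
    ∀ M : Fin (k + 1) → ι, nested X (k + 1) M ∈ level n ((k + 1 : ℕ) * ε) := by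
  induction k with
  | zero => exact fun M => by simpa [nested_one] using hX _
  | succ k ih =>
    intro M
    rw [nested_add_two, show ((k + 1 + 1 : ℕ) : ℤ) * ε = ε + (k + 1 : ℕ) * ε by push_cast; ring]
    exact bracket_mem_level (hX _) (ih _)

theorem levelPower_le_span_nested {ε : ℤ} {X : ι → U n}
    (hX : level n ε ≤ Submodule.span ℝ (Set.range X)) (k : ℕ) :
    levelPower n ε (k + 1) ≤ Submodule.span ℝ (Set.range (nested X (k + 1))) := by
  induction k with
  | zero =>
    refine hX.trans (Submodule.span_mono ?_)
    rintro _ ⟨i, rfl⟩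
    exact ⟨fun _ => i, rfl⟩
  | succ k ih =>
    refine (Submodule.map₂_le_map₂ hX ih).trans ?_
    rw [Submodule.map₂_span_span]
    refine Submodule.span_mono ?_
    rintro _ ⟨_, ⟨i, rfl⟩, _, ⟨M, rfl⟩, rfl⟩
    exact ⟨(Fin.cons i M : Fin (k + 2) → ι), nested_cons X k i M⟩

/-- An element of level `0` acts on nested brackets as a derivation. -/
theorem bracket_level_zero_nested [Fintype ι] [DecidableEq ι] {ε : ℤ} {X : ι → U n}
    (hX : ∀ M, X M ∈ level n ε)
    {x : U n} (hx : x ∈ level n 0) (c : ι → ι → ℝ)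
    (hc : ∀ N, superBracket n x (X N) = ∑ L, c L N • X L) (k : ℕ) :
    ∀ N : Fin (k + 1) → ι, superBracket n x (nested X (k + 1) N) =
      ∑ i, ∑ L, c L (N i) • nested X (k + 1) (Function.update N i L) := by
  induction k with
  | zero => intro N; simp [nested_one, hc]
  | succ k ih =>
    intro N
    rw [nested_add_two, bracket_leibniz hx (hX _), sgn_zero_left, one_smul, ih, hc,
      Fin.sum_univ_succ (n := k + 1)]
    congr 1
    · simp [nested_add_two]
    · rw [map_sum]
      refine Finset.sum_congr rfl fun i _ => ?_
      rw [map_sum]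
      refine Finset.sum_congr rfl fun L _ => ?_
      rw [map_smul, nested_add_two, Fin.tail_update_succ,
        Function.update_of_ne (Fin.succ_ne_zero i).symm]
      rfl

end Nested

/-! ## Sums over multi-indices -/

section Sums

variable {ι V : Type*} [Fintype ι] [AddCommGroup V]

theorem sum_fin_cons {k : ℕ} (g : (Fin (k + 1) → ι) → V) :
    ∑ K, g K = ∑ i, ∑ K : Fin k → ι, g (Fin.cons i K : Fin (k + 1) → ι) := by
  rw [← Fintype.sum_prod_type', ← (Fin.consEquiv fun _ => ι).sum_comp]
  rfl

variable [Module ℝ V] [DecidableEq ι]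

theorem sum_prod_one_tail_smul {k : ℕ} (M : Fin k → ι) (g : (Fin (k + 1) → ι) → V) :
    ∑ K, (∏ i, (1 : Matrix ι ι ℝ) (M i) (K i.succ)) • g K =
      ∑ L, g (Fin.cons L M : Fin (k + 1) → ι) := by
  rw [sum_fin_cons]
  refine Finset.sum_congr rfl fun L _ => ?_
  simp [Matrix.one_apply, Finset.prod_ite_zero, ← funext_iff]

theorem sum_one_head_smul {k : ℕ} (M : ι) (g : (Fin (k + 1) → ι) → V) :
    ∑ K, (1 : Matrix ι ι ℝ) M (K 0) • g K =
      ∑ K : Fin k → ι, g (Fin.cons M K : Fin (k + 1) → ι) := by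
  rw [sum_fin_cons]
  simp [Matrix.one_apply]

theorem sum_prod_one_erase_smul {k : ℕ} (N : Fin k → ι) (i : Fin k) (g : (Fin k → ι) → V) :
    ∑ K, (∏ j ∈ Finset.univ.erase i, (1 : Matrix ι ι ℝ) (K j) (N j)) • g K =
      ∑ L, g (Function.update N i L) := by
  have hinj : Function.Injective (Function.update N i) := Function.update_injective N i
  -- The right side becomes a sum over the multi-indices that agree with `N` away from `i`; every
  -- other `K` has a vanishing delta factor.
  rw [← Finset.sum_image (f := g) (s := Finset.univ) (g := Function.update N i)
    (fun _ _ _ _ h => hinj h)]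
  symm
  rw [← Finset.sum_subset_zero_on_sdiff (Finset.subset_univ _)]
  · intro K hK
    have : ∃ j ∈ Finset.univ.erase i, K j ≠ N j := by
      by_contra! h
      refine (Finset.mem_sdiff.1 hK).2 (Finset.mem_image.2 ⟨K i, Finset.mem_univ _, ?_⟩)
      ext j
      by_cases hj : j = i
      · subst hj; simp
      · rw [Function.update_of_ne hj, h j (by simp [hj])]
    obtain ⟨j, hj, hne⟩ := this
    have h0 : (1 : Matrix ι ι ℝ) (K j) (N j) = 0 := Matrix.one_apply_ne hne
    rw [Finset.prod_eq_zero hj h0, zero_smul]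
  · intro K hK
    obtain ⟨L, _, rfl⟩ := Finset.mem_image.1 hK
    rw [Finset.prod_eq_one, one_smul]
    intro j hj
    rw [Function.update_of_ne (Finset.ne_of_mem_erase hj), Matrix.one_apply_eq]

end Sums

/-! ## The identities -/

section Identities

variable {ι : Type} {B : LinearMap.BilinForm ℝ (U n)} {E F : ι → U n}

/-- An element of level `k + 1` is detected by its pairings with the nested brackets of a spanning
family of level `-1`. -/
theorem IsStandardForm.eq_zero_of_forall_nested (hB : IsStandardForm n B) (hn : 4 ≤ n)
    (hn' : n ≤ 8) (hE : level n (-1) ≤ Submodule.span ℝ (Set.range E)) {k : ℕ} {x : U n}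
    (hx : x ∈ level n (k + 1 : ℕ)) (h : ∀ M, B (nested E (k + 1) M) x = 0) : x = 0 := by
  refine hB.eq_zero_of_forall_level hn hn' hx fun y hy => ?_
  have hy2 := level_le_generatedLevel _ hy
  rw [generatedLevel_neg_natCast] at hy2
  have hle : Submodule.span ℝ (Set.range (nested E (k + 1))) ≤ LinearMap.ker (B.flip x) := by
    refine Submodule.span_le.2 ?_
    rintro _ ⟨M, rfl⟩
    exact h M
  exact hle (levelPower_le_span_nested hE k hy2)

theorem IsStandardForm.eq_of_forall_nested (hB : IsStandardForm n B) (hn : 4 ≤ n)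
    (hn' : n ≤ 8) (hE : level n (-1) ≤ Submodule.span ℝ (Set.range E)) {k : ℕ} {x y : U n}
    (hx : x ∈ level n (k + 1 : ℕ)) (hy : y ∈ level n (k + 1 : ℕ))
    (h : ∀ M, B (nested E (k + 1) M) x = B (nested E (k + 1) M) y) : x = y :=
  sub_eq_zero.1 <| hB.eq_zero_of_forall_nested hn hn' hE (sub_mem hx hy) fun M => by
    rw [map_sub, h, sub_self]

variable [Fintype ι] [DecidableEq ι]

/-- The bracket of nested brackets of levels `-(k + 1)` and `k + 2`. -/
theorem IsStandardForm.bracket_nested_nested_succ (hB : IsStandardForm n B) (hn : 4 ≤ n)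
    (hn' : n ≤ 8) (hE : ∀ M, E M ∈ level n (-1)) (hF : ∀ N, F N ∈ level n 1)
    (hE' : level n (-1) ≤ Submodule.span ℝ (Set.range E))
    (hEF : ∀ M N, B (E M) (F N) = (1 : Matrix ι ι ℝ) M N) {k : ℕ}
    {R : Matrix (Fin (k + 2) → ι) (Fin (k + 2) → ι) ℝ} {b : ℝ}
    (hR : ∀ M N, B (nested E (k + 2) M) (nested F (k + 2) N) = b * R M N)
    (M : Fin (k + 1) → ι) (N : Fin (k + 2) → ι) :
    superBracket n (nested E (k + 1) M) (nested F (k + 2) N) =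
      b • projUpper R
        (fun K => (∏ i : Fin (k + 1), (1 : Matrix ι ι ℝ) (M i) (K i.succ)) • F (K 0)) N := by
  have hl : superBracket n (nested E (k + 1) M) (nested F (k + 2) N) ∈ level n 1 := by
    have h := bracket_mem_level (nested_mem_level hE k M) (nested_mem_level hF (k + 1) N)
    rwa [show ((k + 1 : ℕ) : ℤ) * (-1) + ((k + 1 + 1 : ℕ) : ℤ) * 1 = 1 by push_cast; ring] at h
  refine hB.eq_of_forall_nested hn hn' hE' (k := 0) (by simpa using hl) ?_ fun L => ?_
  · refine Submodule.smul_mem _ _ (Submodule.sum_mem _ fun K _ => Submodule.smul_mem _ _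
      (Submodule.smul_mem _ _ ?_))
    simpa using hF _
  · rw [projUpper]
    simp_rw [smul_comm (R _ N)]
    -- Invariance moves the inner bracket to the left slot, where `E (L 0)` simply lengthens the
    -- nested bracket, without a sign.
    rw [sum_prod_one_tail_smul, ← bracket_eq, ← hB.invariant]
    change B (superBracket n (E (L 0)) _) _ = B (E (L 0)) _
    rw [← nested_cons, hR]
    simp [hEF, Matrix.one_apply]

/-- Since Q is idempotent, the rows of Q - 1 are killed by Q and so are relations among the shorter
brackets. Bracketing them with E_M gives relations among the longer ones, which R kills. -/
theorem projector_absorb {k : ℕ} {Q : Matrix (Fin (k + 1) → ι) (Fin (k + 1) → ι) ℝ}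
    {R : Matrix (Fin (k + 2) → ι) (Fin (k + 2) → ι) ℝ} (hQ : Q * Q = Q)
    (hQl : ∀ c : (Fin (k + 1) → ι) → ℝ, c ᵥ* Q = 0 → ∑ M, c M • nested E (k + 1) M = 0)
    (hRl : ∀ c : (Fin (k + 2) → ι) → ℝ, ∑ M, c M • nested E (k + 2) M = 0 → c ᵥ* R = 0)
    (M : ι) (M' : Fin (k + 1) → ι) (N : Fin (k + 2) → ι) :
    ∑ K : Fin (k + 1) → ι, Q M' K * R (Fin.cons M K : Fin (k + 2) → ι) N =
      R (Fin.cons M M' : Fin (k + 2) → ι) N := by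
  set c : (Fin (k + 1) → ι) → ℝ := fun K => Q M' K - (1 : Matrix _ _ ℝ) M' K with hc
  have h1 : ∑ K, c K • nested E (k + 1) K = 0 := by
    refine hQl c ?_
    have h2 : c = (Q - 1) M' := rfl
    have h3 : (Q - 1) * Q = 0 := by rw [sub_mul, hQ, one_mul, sub_self]
    rw [h2]
    exact congrFun h3 M'
  have h4 := congrFun (hRl (fun K => (1 : Matrix ι ι ℝ) M (K 0) * c (Fin.tail K)) (by
    simp_rw [mul_smul]
    rw [sum_one_head_smul]
    simp_rw [Fin.tail_cons, nested_cons, ← map_smul, ← map_sum, h1, map_zero])) N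
  simp only [Matrix.vecMul, dotProduct, mul_assoc, Pi.zero_apply] at h4
  have h5 := sum_one_head_smul M (fun K : Fin (k + 2) → ι => c (Fin.tail K) * R K N)
  simp only [smul_eq_mul, Fin.tail_cons] at h5
  rw [h4] at h5
  simp only [hc, sub_mul, Finset.sum_sub_distrib] at h5
  rw [← sub_eq_zero, h5]
  simp [Matrix.one_apply]

/-- The bracket of a vector of level `-1` with the nested brackets of level `k + 2`. -/
theorem IsStandardForm.bracket_nested (hB : IsStandardForm n B) (hn : 4 ≤ n)
    (hn' : n ≤ 8) (hE : ∀ M, E M ∈ level n (-1)) (hF : ∀ N, F N ∈ level n 1)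
    (hE' : level n (-1) ≤ Submodule.span ℝ (Set.range E))
    (hF' : level n 1 ≤ Submodule.span ℝ (Set.range F)) {k : ℕ}
    {Q : Matrix (Fin (k + 1) → ι) (Fin (k + 1) → ι) ℝ}
    {R : Matrix (Fin (k + 2) → ι) (Fin (k + 2) → ι) ℝ} {a b : ℝ} (hQQ : Q * Q = Q)
    (hQl : ∀ c : (Fin (k + 1) → ι) → ℝ, c ᵥ* Q = 0 → ∑ M, c M • nested E (k + 1) M = 0)
    (hRl : ∀ c : (Fin (k + 2) → ι) → ℝ, ∑ M, c M • nested E (k + 2) M = 0 → c ᵥ* R = 0)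
    (hQ : ∀ M N, B (nested E (k + 1) M) (nested F (k + 1) N) = a * Q M N)
    (hR : ∀ M N, B (nested E (k + 2) M) (nested F (k + 2) N) = b * R M N)
    (M : ι) (N : Fin (k + 2) → ι) :
    superBracket n (E M) (nested F (k + 2) N) =
      ((-1 : ℝ) ^ (k + 2) * (b / a)) • projUpper R
        (fun K => (1 : Matrix ι ι ℝ) M (K 0) • nested F (k + 1) (Fin.tail K)) N := by
  have hmem (K : Fin (k + 1) → ι) : nested F (k + 1) K ∈ level n (k + 1 : ℕ) := by
    simpa using nested_mem_level hF k K
  have hl : superBracket n (E M) (nested F (k + 2) N) ∈ level n (k + 1 : ℕ) := by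
    have h := bracket_mem_level (hE M) (nested_mem_level hF (k + 1) N)
    rwa [show -1 + ((k + 1 + 1 : ℕ) : ℤ) * 1 = (k + 1 : ℕ) by push_cast; ring] at h
  -- For a = 0 the quotient b / a is 0 by convention, and the left side vanishes because the nested
  -- brackets spanning its level pair to zero.
  rcases eq_or_ne a 0 with rfl | ha
  · rw [div_zero, mul_zero, zero_smul]
    refine hB.eq_zero_of_forall_nested hn hn' hE' hl fun M' => ?_
    have h2 := level_le_generatedLevel _ hl
    rw [generatedLevel_natCast] at h2
    have hle : Submodule.span ℝ (Set.range (nested F (k + 1))) ≤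
        LinearMap.ker (B (nested E (k + 1) M')) := by
      refine Submodule.span_le.2 ?_
      rintro _ ⟨K, rfl⟩
      simpa using hQ M' K
    exact hle (levelPower_le_span_nested hF' k h2)
  · refine hB.eq_of_forall_nested hn hn' hE' hl ?_ fun M' => ?_
    · exact Submodule.smul_mem _ _ (Submodule.sum_mem _ fun K _ => Submodule.smul_mem _ _
        (Submodule.smul_mem _ _ (hmem _)))
    · rw [projUpper]
      simp_rw [smul_comm (R _ N)]
      -- Reversing the bracket of E_{M'} and E_M costs -(-1)^{k+1} = (-1)^{k+2}, the sign in the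
      -- identity.
      rw [sum_one_head_smul, ← bracket_eq, ← hB.invariant, bracket_eq,
        bracket_skew (nested_mem_level hE k M') (hE M), ← nested_cons]
      have hs : sgn (((k + 1 : ℕ) : ℤ) * -1) (-1) = (-1) ^ (k + 1) := by
        rw [sgn, mul_assoc, neg_mul_neg, one_mul, mul_one, zpow_natCast]
      simp only [map_neg, map_smul, map_sum, LinearMap.neg_apply, LinearMap.smul_apply,
        smul_eq_mul, hR, hs, Fin.tail_cons, hQ]
      rw [← projector_absorb hQQ hQl hRl M M' N, Finset.mul_sum, Finset.mul_sum, Finset.mul_sum,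
        ← Finset.sum_neg_distrib]
      refine Finset.sum_congr rfl fun K _ => ?_
      field_simp
      ring

theorem IsStandardForm.apply_bracket_of_level_zero (hB : IsStandardForm n B) {p : ℤ} {x y : U n}
    (hx : x ∈ level n 0) (hy : y ∈ level n p) (z : U n) :
    B x (superBracket n y z) = -B y (superBracket n x z) := by
  rw [← bracket_eq, ← hB.invariant, bracket_eq, bracket_skew hx hy, sgn_zero_left, one_smul,
    map_neg, LinearMap.neg_apply, ← bracket_eq, hB.invariant]
  rfl

/-- The action of level `0` on a basis of level `1`, in terms of the form. -/
theorem IsStandardForm.bracket_level_zero_eq_sum (hB : IsStandardForm n B)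
    (hE : ∀ M, E M ∈ level n (-1)) (hF : ∀ N, F N ∈ level n 1)
    (hF' : level n 1 ≤ Submodule.span ℝ (Set.range F))
    (hEF : ∀ M N, B (E M) (F N) = (1 : Matrix ι ι ℝ) M N) {x : U n} (hx : x ∈ level n 0) (j : ι) :
    superBracket n x (F j) = ∑ L, (-B x (superBracket n (E L) (F j))) • F L := by
  have hxj : superBracket n x (F j) ∈ level n 1 := by
    simpa using bracket_mem_level hx (hF j)
  obtain ⟨c, hc⟩ := (Submodule.mem_span_range_iff_exists_fun ℝ).1 (hF' hxj)
  rw [← hc]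
  refine Finset.sum_congr rfl fun L _ => ?_
  rw [hB.apply_bracket_of_level_zero hx (hE L), ← hc]
  simp [hEF, Matrix.one_apply]

theorem projLower_sum_prod_one_erase {V : Type} [AddCommGroup V] [Module ℝ V] {k : ℕ}
    (R : Matrix (Fin k → ι) (Fin k → ι) ℝ) (G : ι → Fin k → V) (M N : Fin k → ι) :
    projLower R (fun K => ∑ i, (∏ j ∈ Finset.univ.erase i, (1 : Matrix ι ι ℝ) (K j) (N j)) •
        G (K i) i) M =
      ∑ i, ∑ L, R M (Function.update N i L) • G L i := by
  simp_rw [projLower, Finset.smul_sum]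
  rw [Finset.sum_comm]
  refine Finset.sum_congr rfl fun i _ => ?_
  simp_rw [smul_comm (R M _)]
  rw [sum_prod_one_erase_smul N i fun K => R M K • G (K i) i]
  simp

/-- The bracket of nested brackets of opposite levels. -/
theorem IsStandardForm.bracket_nested_nested (hB : IsStandardForm n B) (hn : 4 ≤ n)
    (hn' : n ≤ 8) (hE : ∀ M, E M ∈ level n (-1)) (hF : ∀ N, F N ∈ level n 1)
    (hF' : level n 1 ≤ Submodule.span ℝ (Set.range F))
    (hEF : ∀ M N, B (E M) (F N) = (1 : Matrix ι ι ℝ) M N) {k : ℕ}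
    {R : Matrix (Fin (k + 1) → ι) (Fin (k + 1) → ι) ℝ} {b : ℝ}
    (hR : ∀ M N, B (nested E (k + 1) M) (nested F (k + 1) N) = b * R M N)
    (M N : Fin (k + 1) → ι) :
    superBracket n (nested E (k + 1) M) (nested F (k + 1) N) =
      b • projLower R (fun K => ∑ i : Fin (k + 1),
        (∏ j ∈ Finset.univ.erase i, (1 : Matrix ι ι ℝ) (K j) (N j)) •
          superBracket n (E (K i)) (F (N i))) M := by
  have hl : superBracket n (nested E (k + 1) M) (nested F (k + 1) N) ∈ level n 0 := by
    have h := bracket_mem_level (nested_mem_level hE k M) (nested_mem_level hF k N)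
    rwa [mul_neg, neg_add_cancel] at h
  have hl' (i j : ι) : superBracket n (E i) (F j) ∈ level n 0 := by
    simpa using bracket_mem_level (hE i) (hF j)
  rw [projLower_sum_prod_one_erase R (fun L i => superBracket n (E L) (F (N i))) M N, ← sub_eq_zero]
  have hr : b • ∑ i, ∑ L, R M (Function.update N i L) • superBracket n (E L) (F (N i)) ∈
      level n 0 :=
    Submodule.smul_mem _ _ (Submodule.sum_mem _ fun i _ => Submodule.sum_mem _ fun L _ =>
      Submodule.smul_mem _ _ (hl' _ _))
  refine hB.eq_zero_of_forall_level hn hn' (sub_mem hl hr) fun x hx => ?_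
  rw [neg_zero] at hx
  have hxF := hB.bracket_level_zero_eq_sum hE hF hF' hEF hx
  -- The minus sign from moving `x` onto F^N cancels the one in the matrix of `x` on level 1.
  rw [map_sub, hB.apply_bracket_of_level_zero hx (nested_mem_level hE k M),
    bracket_level_zero_nested hF hx _ hxF]
  simp only [map_sum, map_smul, smul_eq_mul, hR, neg_mul, Finset.sum_neg_distrib, neg_neg,
    Finset.mul_sum]
  rw [sub_eq_zero]
  refine Finset.sum_congr rfl fun i _ => Finset.sum_congr rfl fun L _ => ?_
  ring

end Identities

/-- A single nonzero value rules out the default form 0, so existence of the standard form need not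
be proved separately. -/
theorem isStandardForm_form {x y : U n} (h : form n x y ≠ 0) : IsStandardForm n (form n) := by
  by_cases hB : ∃ B, IsStandardForm n B
  · rw [form, dif_pos hB]
    exact hB.choose_spec
  · simp [form, dif_neg hB] at h

theorem level_le_span_basis {ι : Type} {p : ℤ} (b : Module.Basis ι ℝ (level n p)) :
    level n p ≤ Submodule.span ℝ (Set.range fun i => (b i : U n)) := by
  have h := congrArg (Submodule.map (level n p).subtype) b.span_eq
  rw [Submodule.map_span, ← Set.range_comp, Submodule.map_top, Submodule.range_subtype] at h
  exact h.ge

end BorcherdsE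

end

/-- The integer `p ≥ 2` is written as `p = q + 1`, and `(1 : Matrix ι ι ℝ)` is the Kronecker delta.
The number `a 1 = 1` belongs to the normalization of the bases on levels `-1` and `1`. -/
theorem mainTheorem2 (n : ℕ) (hn : 4 ≤ n) (hn' : n ≤ 8)
    {ι : Type} [Fintype ι] [DecidableEq ι]
    (E : Module.Basis ι ℝ (BorcherdsE.level n (-1))) (F : Module.Basis ι ℝ (BorcherdsE.level n 1))
    (hEF : ∀ M N, BorcherdsE.form n (E M) (F N) = (1 : Matrix ι ι ℝ) M N)
    (q : ℕ) (hq : 1 ≤ q)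
    (P : (k : ℕ) → Matrix (Fin k → ι) (Fin k → ι) ℝ)
    (hP : ∀ k, 2 ≤ k → k ≤ q + 1 →
      BorcherdsE.IsLevelProjector (fun M => (E M : BorcherdsE.U n)) (fun N => (F N : BorcherdsE.U n))
        (P k))
    (a : ℕ → ℝ) (ha1 : a 1 = 1)
    (ha : ∀ k, 2 ≤ k → k ≤ q + 1 → ∀ M N : Fin k → ι,
      BorcherdsE.form n (BorcherdsE.nested (fun M => (E M : BorcherdsE.U n)) k M)
        (BorcherdsE.nested (fun N => (F N : BorcherdsE.U n)) k N) = a k * P k M N) :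
    (∀ (M : ι) (N : Fin (q + 1) → ι),
      ⁅(E M : BorcherdsE.U n), BorcherdsE.nested (fun N => (F N : BorcherdsE.U n)) (q + 1) N⁆ =
        ((-1 : ℝ) ^ (q + 1) * (a (q + 1) / a q)) •
          BorcherdsE.projUpper (P (q + 1))
            (fun K => (1 : Matrix ι ι ℝ) M (K 0) •
              BorcherdsE.nested (fun N => (F N : BorcherdsE.U n)) q (Fin.tail K)) N) ∧
    (∀ (M : Fin q → ι) (N : Fin (q + 1) → ι),
      ⁅BorcherdsE.nested (fun M => (E M : BorcherdsE.U n)) q M,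
          BorcherdsE.nested (fun N => (F N : BorcherdsE.U n)) (q + 1) N⁆ =
        a (q + 1) •
          BorcherdsE.projUpper (P (q + 1))
            (fun K => (∏ i : Fin q, (1 : Matrix ι ι ℝ) (M i) (K i.succ)) •
              (F (K 0) : BorcherdsE.U n)) N) ∧
    (∀ M N : Fin (q + 1) → ι,
      ⁅BorcherdsE.nested (fun M => (E M : BorcherdsE.U n)) (q + 1) M,
          BorcherdsE.nested (fun N => (F N : BorcherdsE.U n)) (q + 1) N⁆ =
        a (q + 1) •
          BorcherdsE.projLower (P (q + 1))
            (fun K => ∑ i : Fin (q + 1),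
              (∏ j ∈ Finset.univ.erase i, (1 : Matrix ι ι ℝ) (K j) (N j)) •
                ⁅(E (K i) : BorcherdsE.U n), (F (N i) : BorcherdsE.U n)⁆) M) := by
  -- With no indices every identity is vacuous; otherwise ⟨E_{i₀}|F^{i₀}⟩ = 1 shows that the form is
  -- standard.
  rcases isEmpty_or_nonempty ι with hι | ⟨⟨i₀⟩⟩
  · exact ⟨fun M => isEmptyElim M, fun _ N => isEmptyElim (N 0), fun M => isEmptyElim (M 0)⟩
  have hB : BorcherdsE.IsStandardForm n (BorcherdsE.form n) :=
    BorcherdsE.isStandardForm_form (x := E i₀) (y := F i₀) (by simp [hEF])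
  obtain ⟨k, rfl⟩ : ∃ k, q = k + 1 := ⟨q - 1, by lia⟩
  have hE M := (E M).2
  have hF N := (F N).2
  have hE' := BorcherdsE.level_le_span_basis E
  have hF' := BorcherdsE.level_le_span_basis F
  have hR := ha (k + 2) (by lia) le_rfl
  have hPR := hP (k + 2) (by lia) le_rfl
  refine ⟨fun M N => ?_, hB.bracket_nested_nested_succ hn hn' hE hF hE' hEF hR,
    hB.bracket_nested_nested hn hn' hE hF hF' hEF hR⟩
  rcases Nat.eq_zero_or_pos k with rfl | hk
  · refine hB.bracket_nested hn hn' hE hF hE' hF' (Q := 1) (one_mul 1) ?_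
      (fun c => (hPR.lower c).2) (fun M N => ?_) hR M N
    · intro c hc
      rw [Matrix.vecMul_one] at hc
      simp [hc]
    · rw [BorcherdsE.nested_one, BorcherdsE.nested_one, hEF, ha1, one_mul, Matrix.one_apply,
        Matrix.one_apply]
      exact if_congr (by simp [funext_iff]) rfl rfl
  · have hPQ := hP (k + 1) (by lia) (by lia)
    exact hB.bracket_nested hn hn' hE hF hE' hF' hPQ.idem (fun c => (hPQ.lower c).1)
      (fun c => (hPR.lower c).2) (ha (k + 1) (by lia) (by lia)) hR M N
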